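/- **Theorem (Properties of the MEM function).** Let $\nu$ be either Lebesgue measure on $\Omega=\mathbb R^d$ or the counting measure on a countable set $\Omega\subset\mathbb R^d$, and let $\mathcal P(\Omega)$ be the set of probability measures on $\Omega$ that are absolutely continuous with respect to $\nu$. For $P\in\mathcal P(\Omega)$ let $\Omega_P$ be its support, $\mathbb E_P=\int y\,dP(y)$ its expected value (if it exists), $M_P[\theta]=\int_\Omega e^{\langle y,\theta\rangle}\,dP(y)\in(0,+\infty]$ its moment generating function, $\Theta_P=\{\theta\in\mathbb R^d: M_P[\theta]<\infty\}$, and $\psi_P=\log M_P:\mathbb R^d\to(-\infty,+\infty]$. The MEM function is $$\kappa_P(y)=\inf\{\mathrm{KL}(Q\,\|\,P): Q\in\mathcal P(\Omega),\ \mathbb E_Q \text{ exists and } \mathbb E_Q=y\}\qquad(y\in\mathbb R^d),$$ where $\inf\emptyset=+\infty$ and $\mathrm{KL}(Q\,\|\,P)=\int\log\frac{dQ}{dP}\,dQ$ if $Q\ll P$ and $+\infty$ otherwise. A proper convex function $f:\mathbb R^d\to(-\infty,+\infty]$ with domain $\operatorname{dom} f=\{f<+\infty\}$ is *essentially smooth*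 if $\operatorname{int}(\operatorname{dom} f)\ne\emptyset$, $f$ is differentiable on $\operatorname{int}(\operatorname{dom} f)$, and $\|\nabla f(x^k)\|\to\infty$ for every sequence $(x^k)$ in $\operatorname{int}(\operatorname{dom} f)$ converging to a boundary point of $\operatorname{dom} f$. It is *of Legendre type* if it is moreover strictly convex on $\operatorname{int}(\operatorname{dom} f)$. Let $P\in\mathcal P(\Omega)$ satisfy: 1. (minimal) $\operatorname{int}\Theta_P\neq\emptyset$ and $\operatorname{int}\overline{\operatorname{conv}}\,\Omega_P\ne\emptyset$; 2. (steep) $\psi_P$ is essentially smooth; 3. $0\in\operatorname{int}\Theta_P$; 4. either $\Omega_P$ is uncountable, or $\Omega_P$ is countable and $\operatorname{conv}\Omega_P$ is closed. Then: (a) $\mathbb E_P$ exists, and $\kappa_P(y)\ge 0$ for all $y\in\mathbb R^d$, with equality if and only if $y=\mathbb E_P$. (b) $\kappa_P$ is of Legendre type (in particular proper and convex). (c) $\kappa_P$ is coercive: $\lim_{\|y\|\to\infty}\kappa_P(y)=+\infty$. In particular, $\kappa_P$ is level bounded, i.e. $\{y:\kappa_P(y)\le\alpha\}$ is bounded for every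 $\alpha\in\mathbb R$. (d) If $M_P[\theta]<\infty$ for all $\theta\in\mathbb R^d$, then $\kappa_P$ is supercoercive: $\lim_{\|y\|\to\infty}\kappa_P(y)/\|y\|=+\infty$. The condition on $M_P$ holds, in particular, if $\Omega_P$ is bounded. -/

import Mathlib

open MeasureTheory Filter Topology Set
open scoped ENNReal InnerProductSpace

namespace MEM

noncomputable section

/-! ### Extended-real-valued functions on a Euclidean space -/

section ConvexAnalysis

variable {d : ℕ}

/-- The effective domain `{x | f x < +∞}`. -/
def dom (f : EuclideanSpace ℝ (Fin d) → EReal) : Set (EuclideanSpace ℝ (Fin d)) :=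
  {x | f x < ⊤}

/-- `f` is proper: it never takes the value `-∞` and its domain is nonempty. -/
def IsProper (f : EuclideanSpace ℝ (Fin d) → EReal) : Prop :=
  (∀ x, f x ≠ ⊥) ∧ (dom f).Nonempty

/-- `f` is convex: its epigraph is a convex set. -/
def IsConvex (f : EuclideanSpace ℝ (Fin d) → EReal) : Prop :=
  Convex ℝ {p : EuclideanSpace ℝ (Fin d) × ℝ | f p.1 ≤ (p.2 : EReal)}

/-- The three conditions that make a proper convex function essentially smooth. For a proper `f`,
the function `(f ·).toReal` is `f` itself on the domain of `f`, and differentiability and the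
gradient are considered only at points of the (open) interior of the domain. -/
structure IsEssentiallySmooth (f : EuclideanSpace ℝ (Fin d) → EReal) : Prop where
  interior_nonempty : (interior (dom f)).Nonempty
  differentiable : ∀ x ∈ interior (dom f), DifferentiableAt ℝ (fun z => (f z).toReal) x
  steep : ∀ (x : EuclideanSpace ℝ (Fin d)) (u : ℕ → EuclideanSpace ℝ (Fin d)),
    x ∈ frontier (dom f) → (∀ k, u k ∈ interior (dom f)) → Tendsto u atTop (𝓝 x) →
      Tendsto (fun k => ‖gradient (fun z => (f z).toReal) (u k)‖) atTop atTop

/-- `f` is of Legendre type: proper, convex, essentially smooth, and strictly convex on the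
interior of its domain. -/
structure IsLegendre (f : EuclideanSpace ℝ (Fin d) → EReal) : Prop where
  proper : IsProper f
  convex : IsConvex f
  essentiallySmooth : IsEssentiallySmooth f
  strictConvex : StrictConvexOn ℝ (interior (dom f)) (fun z => (f z).toReal)

/-- `f y → +∞` as `‖y‖ → ∞`. -/
def IsCoercive (f : EuclideanSpace ℝ (Fin d) → EReal) : Prop :=
  Tendsto f (Bornology.cobounded (EuclideanSpace ℝ (Fin d))) (𝓝 ⊤)

/-- All sublevel sets at real levels are bounded. -/
def IsLevelBounded (f : EuclideanSpace ℝ (Fin d) → EReal) : Prop :=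
  ∀ α : ℝ, Bornology.IsBounded {y | f y ≤ (α : EReal)}

/-- `f y / ‖y‖ → +∞` as `‖y‖ → ∞`. -/
def IsSupercoercive (f : EuclideanSpace ℝ (Fin d) → EReal) : Prop :=
  Tendsto (fun y => f y / ((‖y‖ : ℝ) : EReal))
    (Bornology.cobounded (EuclideanSpace ℝ (Fin d))) (𝓝 ⊤)

end ConvexAnalysis

/-! ### Distributions, exponential families and the MEM function -/

section Probability

variable {d : ℕ}

/-- The admissible dominating measures: Lebesgue measure on `ℝᵈ`, or the counting measure of a
countable set `Ω ⊆ ℝᵈ` (regarded as a measure on `ℝᵈ` that lives on `Ω`). -/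
def IsDominating (ν : Measure (EuclideanSpace ℝ (Fin d))) : Prop :=
  ν = volume ∨ ∃ Ω : Set (EuclideanSpace ℝ (Fin d)), Ω.Countable ∧ ν = Measure.count.restrict Ω

/-- The class `𝒫(Ω)` of probability measures absolutely continuous with respect to the dominating
measure `ν`. (For `ν` the counting measure of `Ω`, absolute continuity says that the measure is
concentrated on `Ω`.) -/
def distributions (ν : Measure (EuclideanSpace ℝ (Fin d))) :
    Set (Measure (EuclideanSpace ℝ (Fin d))) :=
  {Q | IsProbabilityMeasure Q ∧ Q ≪ ν}

/-- The expected value of `Q` exists and equals `y`. -/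
def HasMean (Q : Measure (EuclideanSpace ℝ (Fin d))) (y : EuclideanSpace ℝ (Fin d)) : Prop :=
  Integrable (fun x => x) Q ∧ ∫ x, x ∂Q = y

/-- The moment generating function `M_P[θ] = ∫ exp ⟪x, θ⟫ dP(x) ∈ [0, +∞]`. -/
def momentGen (P : Measure (EuclideanSpace ℝ (Fin d))) (θ : EuclideanSpace ℝ (Fin d)) : ℝ≥0∞ :=
  ∫⁻ x, ENNReal.ofReal (Real.exp ⟪x, θ⟫_ℝ) ∂P

/-- The natural parameter space `Θ_P = {θ | M_P[θ] < +∞}`. -/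
def naturalSpace (P : Measure (EuclideanSpace ℝ (Fin d))) : Set (EuclideanSpace ℝ (Fin d)) :=
  {θ | momentGen P θ < ∞}

/-- The log-normalizer `ψ_P(θ) = log M_P[θ]`, equal to `+∞` outside of `Θ_P`. -/
def logNormalizer (P : Measure (EuclideanSpace ℝ (Fin d))) (θ : EuclideanSpace ℝ (Fin d)) :
    EReal :=
  ENNReal.log (momentGen P θ)

/-- The convex support: the closure of the convex hull of the support. -/
def convexSupport (P : Measure (EuclideanSpace ℝ (Fin d))) : Set (EuclideanSpace ℝ (Fin d)) :=
  closure (convexHull ℝ P.support)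

/-- The exponential family generated by `P` is minimal: the natural parameter space and the convex
support are both full-dimensional. -/
def IsMinimalFamily (P : Measure (EuclideanSpace ℝ (Fin d))) : Prop :=
  (interior (naturalSpace P)).Nonempty ∧ (interior (convexSupport P)).Nonempty

/-- The exponential family generated by `P` is steep: the log-normalizer is essentially smooth. -/
def IsSteepFamily (P : Measure (EuclideanSpace ℝ (Fin d))) : Prop :=
  IsEssentiallySmooth (logNormalizer P)

/-- The MEM function with reference distribution `P`,
`κ_P(y) = inf {KL(Q ‖ P) : 𝔼_Q = y, Q ∈ 𝒫(Ω)}`, with the value `+∞` where no `Q` is feasible. -/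
def memFunction (ν P : Measure (EuclideanSpace ℝ (Fin d))) (y : EuclideanSpace ℝ (Fin d)) :
    EReal :=
  ⨅ Q ∈ {Q | Q ∈ distributions ν ∧ HasMean Q y}, (InformationTheory.klDiv Q P : EReal)

end Probability

end

end MEM

open scoped NNReal

namespace MEM

/-! ### Exponential families: means, Pythagorean identity, injectivity of the mean map. -/

section ExponentialFamily

variable {d : ℕ} {P Q : Measure (EuclideanSpace ℝ (Fin d))} {θ y : EuclideanSpace ℝ (Fin d)}

/-! On the interior of the convex support, `κ` is the Legendre conjugate of `ψ`, with all the
information carried by the mean map `θ ↦ meanParam P θ = ∇ψ(θ)`. The Pythagorean identity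
`toReal_klDiv_eq_add` writes `KL(Q‖P)` as `⟪y, θ⟫ - ψ(θ)` plus a nonnegative divergence from the
tilted measure. Hence `κ(y) ≥ ⟪y, θ⟫ - ψ(θ)` for every `θ` in `Θ_P` (`le_memFunction`), with
equality when `y` is the mean of an interior `θ` (`memFunction_meanParam`).

The mean map is a bijection from `int Θ_P` onto the interior of the convex support: full dimension
gives injectivity (`meanParam_injOn`), and minimizing `ψ - ⟪y, ·⟫`, with steepness excluding
boundary minimizers, gives surjectivity (`exists_meanParam_eq`). Its inverse is continuous and is
`∇κ`. Strict subgradient inequalities for `ψ` transfer to `κ`, and steepness of `κ` holds because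
bounded natural parameters would force the limiting mean into the interior. Boundary values of `κ`
never have to be computed.

The zero set and the growth of `κ` come from the lower bound alone, evaluated near `0` and on balls
inside `Θ_P`. -/

/-- The log-normalizer as a real-valued function (with the value `0` outside `Θ_P`). -/
noncomputable def psi (P : Measure (EuclideanSpace ℝ (Fin d))) (θ : EuclideanSpace ℝ (Fin d)) : ℝ :=
  Real.log (∫ x, Real.exp ⟪x, θ⟫_ℝ ∂P)

/-- The member of the exponential family of `P` with natural parameter `θ`. -/
noncomputable def expFamily (P : Measure (EuclideanSpace ℝ (Fin d)))
    (θ : EuclideanSpace ℝ (Fin d)) : Measure (EuclideanSpace ℝ (Fin d)) :=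
  P.tilted (fun x => ⟪x, θ⟫_ℝ)

/-- The mean of the member of the exponential family with natural parameter `θ`. -/
noncomputable def meanParam (P : Measure (EuclideanSpace ℝ (Fin d)))
    (θ : EuclideanSpace ℝ (Fin d)) : EuclideanSpace ℝ (Fin d) :=
  ∫ x, x ∂(expFamily P θ)

lemma mem_naturalSpace_iff :
    θ ∈ naturalSpace P ↔ Integrable (fun x => Real.exp ⟪x, θ⟫_ℝ) P := by
  have hm : AEStronglyMeasurable (fun x => Real.exp ⟪x, θ⟫_ℝ) P :=
    (by fun_prop : Continuous fun x : EuclideanSpace ℝ (Fin d) => Real.exp ⟪x, θ⟫_ℝ)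
      |>.aestronglyMeasurable
  rw [← lintegral_ofReal_ne_top_iff_integrable hm (ae_of_all _ fun _ => (Real.exp_pos _).le),
    ← lt_top_iff_ne_top]
  rfl

lemma momentGen_eq_ofReal (hθ : θ ∈ naturalSpace P) :
    momentGen P θ = ENNReal.ofReal (∫ x, Real.exp ⟪x, θ⟫_ℝ ∂P) :=
  (ofReal_integral_eq_lintegral_ofReal (mem_naturalSpace_iff.1 hθ)
    (ae_of_all _ fun _ => (Real.exp_pos _).le)).symm

/-- Outside `Θ_P` both sides are the default value `0`, so the functions agree everywhere and their
derivatives can be exchanged. -/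
lemma toReal_logNormalizer : (logNormalizer P θ).toReal = psi P θ := by
  by_cases hθ : θ ∈ naturalSpace P
  · rw [logNormalizer, momentGen_eq_ofReal hθ, psi]
    rcases (integral_nonneg fun x => (Real.exp_pos ⟪x, θ⟫_ℝ).le :
      0 ≤ ∫ x, Real.exp ⟪x, θ⟫_ℝ ∂P).eq_or_lt with h | h
    · simp [← h]
    · rw [ENNReal.log_ofReal_of_pos h, EReal.toReal_coe]
  · have h : momentGen P θ = ⊤ := by simpa [naturalSpace] using hθ
    rw [logNormalizer, h, psi, integral_undef (mt mem_naturalSpace_iff.2 hθ)]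
    simp

lemma dom_logNormalizer : dom (logNormalizer P) = naturalSpace P := by
  ext θ
  simp [dom, naturalSpace, logNormalizer, lt_top_iff_ne_top]

lemma expFamily_absolutelyContinuous : expFamily P θ ≪ P :=
  tilted_absolutelyContinuous _ _

lemma absolutelyContinuous_expFamily (hθ : θ ∈ naturalSpace P) : P ≪ expFamily P θ :=
  absolutelyContinuous_tilted (mem_naturalSpace_iff.1 hθ)

lemma isProbabilityMeasure_expFamily [IsProbabilityMeasure P] (hθ : θ ∈ naturalSpace P) :
    IsProbabilityMeasure (expFamily P θ) :=
  isProbabilityMeasure_tilted (mem_naturalSpace_iff.1 hθ)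

lemma expFamily_zero [IsProbabilityMeasure P] : expFamily P 0 = P := by
  simp [expFamily]

lemma psi_zero [IsProbabilityMeasure P] : psi P 0 = 0 := by
  simp [psi]

lemma integral_exp_inner_pos [IsProbabilityMeasure P] (hθ : θ ∈ naturalSpace P) :
    0 < ∫ x, Real.exp ⟪x, θ⟫_ℝ ∂P :=
  _root_.MeasureTheory.integral_exp_pos (mem_naturalSpace_iff.1 hθ)

/-- The Pythagorean identity for the exponential family. -/
lemma toReal_klDiv_eq_add [IsProbabilityMeasure P] [IsProbabilityMeasure Q]
    (hθ : θ ∈ naturalSpace P) (hQ : HasMean Q y) (hkl : InformationTheory.klDiv Q P ≠ ⊤) :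
    (InformationTheory.klDiv Q P).toReal =
      ⟪y, θ⟫_ℝ - psi P θ + (InformationTheory.klDiv Q (expFamily P θ)).toReal := by
  have := isProbabilityMeasure_expFamily hθ
  obtain ⟨hac, hint⟩ := InformationTheory.klDiv_ne_top_iff.1 hkl
  have hmean : ∫ x, ⟪x, θ⟫_ℝ ∂Q = ⟪y, θ⟫_ℝ := by
    rw [← hQ.2, real_inner_comm, ← integral_inner hQ.1]
    simp_rw [real_inner_comm]
  rw [InformationTheory.toReal_klDiv_of_measure_eq hac (by simp),
    InformationTheory.toReal_klDiv_of_measure_eq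
      (hac.trans (absolutelyContinuous_expFamily hθ)) (by simp), expFamily,
    integral_llr_tilted_right hac (hQ.1.inner_const θ) (mem_naturalSpace_iff.1 hθ) hint, hmean, psi]
  ring

lemma klDiv_expFamily_ne_top [IsProbabilityMeasure P] (hθ : θ ∈ naturalSpace P)
    (hint : Integrable (fun x => x) (expFamily P θ)) :
    InformationTheory.klDiv (expFamily P θ) P ≠ ⊤ := by
  have := isProbabilityMeasure_expFamily hθ
  refine InformationTheory.klDiv_ne_top expFamily_absolutelyContinuous ?_
  have h := (expFamily_absolutelyContinuous (θ := θ)).ae_eq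
    (log_rnDeriv_tilted_left_self (mem_naturalSpace_iff.1 hθ))
  exact ((hint.inner_const θ).sub (integrable_const _)).congr h.symm

lemma toReal_klDiv_expFamily [IsProbabilityMeasure P] (hθ : θ ∈ naturalSpace P)
    (hint : Integrable (fun x => x) (expFamily P θ)) :
    (InformationTheory.klDiv (expFamily P θ) P).toReal = ⟪meanParam P θ, θ⟫_ℝ - psi P θ := by
  have := isProbabilityMeasure_expFamily hθ
  rw [toReal_klDiv_eq_add hθ ⟨hint, rfl⟩ (klDiv_expFamily_ne_top hθ hint),
    InformationTheory.klDiv_self]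
  simp [meanParam]

/-- Tilting by `θ` and then by `t • u` is tilting by `θ + t • u`, which stays in `Θ_P` for small
`t`. This opens the one-dimensional theory of moment generating functions along each line. -/
lemma zero_mem_interior_integrableExpSet [IsProbabilityMeasure P]
    (hθ : θ ∈ interior (naturalSpace P)) (u : EuclideanSpace ℝ (Fin d)) :
    0 ∈ interior (ProbabilityTheory.integrableExpSet (fun x => ⟪x, u⟫_ℝ) (expFamily P θ)) := by
  have hc : ContinuousAt (fun t : ℝ => θ + t • u) 0 := by fun_prop
  rw [mem_interior_iff_mem_nhds]
  have := hc.preimage_mem_nhds (t := naturalSpace P)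
    (by simpa using mem_interior_iff_mem_nhds.1 hθ)
  refine mem_of_superset this fun t ht => ?_
  have ht' := mem_naturalSpace_iff.1 ht
  simp only [ProbabilityTheory.integrableExpSet, mem_ofPred_eq, expFamily]
  rw [integrable_tilted_iff (mem_naturalSpace_iff.1 (interior_subset hθ))]
  refine ht'.congr (ae_of_all _ fun x => ?_)
  simp [inner_add_right, inner_smul_right, Real.exp_add]

lemma integrable_id_expFamily [IsProbabilityMeasure P] (hθ : θ ∈ interior (naturalSpace P)) :
    Integrable (fun x => x) (expFamily P θ) := by
  let b := EuclideanSpace.basisFun (Fin d) ℝ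
  have h : Integrable (fun x => ∑ i, ⟪x, b i⟫_ℝ • b i) (expFamily P θ) :=
    integrable_finsetSum _ fun i _ =>
      (ProbabilityTheory.integrable_of_mem_interior_integrableExpSet
        (zero_mem_interior_integrableExpSet hθ (b i))).smul_const _
  refine h.congr (ae_of_all _ fun x => ?_)
  simp only [real_inner_comm (b _) x]
  simpa [real_inner_comm] using b.sum_repr' x

lemma cgf_expFamily [IsProbabilityMeasure P] (hθ : θ ∈ naturalSpace P)
    {u : EuclideanSpace ℝ (Fin d)} {t : ℝ} (ht : θ + t • u ∈ naturalSpace P) :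
    ProbabilityTheory.cgf (fun x => ⟪x, u⟫_ℝ) (expFamily P θ) t =
      psi P (θ + t • u) - psi P θ := by
  rw [ProbabilityTheory.cgf, ProbabilityTheory.mgf, expFamily, integral_exp_tilted,
    psi, psi, ← Real.log_div (integral_exp_inner_pos ht).ne' (integral_exp_inner_pos hθ).ne']
  simp [inner_add_right, inner_smul_right]

/-- At interior points the gradient of the log-normalizer is the mean parameter. -/
lemma hasGradientAt_psi [IsProbabilityMeasure P] (hθ : θ ∈ interior (naturalSpace P))
    (hd : DifferentiableAt ℝ (psi P) θ) : HasGradientAt (psi P) (meanParam P θ) θ := by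
  have := isProbabilityMeasure_expFamily (interior_subset hθ)
  have hg := hd.hasGradientAt
  suffices gradient (psi P) θ = meanParam P θ from this ▸ hg
  -- Differentiability is given, so the gradient is identified direction by direction: the
  -- derivative of a cumulant generating function at `0` is a mean.
  refine ext_inner_right ℝ fun u => ?_
  have h0 := zero_mem_interior_integrableExpSet hθ u
  have hl : HasDerivAt (fun t : ℝ => θ + t • u) u 0 := by
    simpa using ((hasDerivAt_id (0 : ℝ)).smul_const u).const_add θ
  have h1 : HasDerivAt (fun t : ℝ => psi P (θ + t • u)) ⟪gradient (psi P) θ, u⟫_ℝ 0 := by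
    have hg' : HasFDerivAt (psi P) (InnerProductSpace.toDual ℝ _ (gradient (psi P) θ))
        (θ + (0 : ℝ) • u) := by simpa using hg.hasFDerivAt
    exact hg'.comp_hasDerivAt (0 : ℝ) hl
  have h2 : ProbabilityTheory.cgf (fun x => ⟪x, u⟫_ℝ) (expFamily P θ) =ᶠ[𝓝 0]
      fun t => psi P (θ + t • u) - psi P θ := by
    have hc : ContinuousAt (fun t : ℝ => θ + t • u) 0 := hl.continuousAt
    filter_upwards [hc.preimage_mem_nhds (t := naturalSpace P)
      (by simpa using mem_interior_iff_mem_nhds.1 hθ)] with t ht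
    exact cgf_expFamily (interior_subset hθ) ht
  have h3 := ((h1.sub_const (psi P θ)).congr_of_eventuallyEq h2).deriv
  rw [ProbabilityTheory.deriv_cgf_zero h0] at h3
  rw [← h3, meanParam, real_inner_comm, ← integral_inner (integrable_id_expFamily hθ)]
  simp [real_inner_comm]

/-! ### Convex support and the location of means. -/

lemma ae_mem_convexSupport : ∀ᵐ x ∂P, x ∈ convexSupport P := by
  filter_upwards [Measure.support_mem_ae (μ := P)] with x hx
  exact subset_closure (subset_convexHull ℝ _ hx)

lemma convex_convexSupport : Convex ℝ (convexSupport P) := (convex_convexHull ℝ _).closure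

lemma isClosed_convexSupport : IsClosed (convexSupport P) := isClosed_closure

lemma mem_convexSupport_of_hasMean [IsProbabilityMeasure Q] (hac : Q ≪ P) (hQ : HasMean Q y) :
    y ∈ convexSupport P :=
  hQ.2 ▸ convex_convexSupport.integral_mem isClosed_convexSupport
    (hac.ae_le ae_mem_convexSupport) hQ.1

/-- A full-dimensional measure is not concentrated on a hyperplane. -/
lemma eq_zero_of_ae_inner_eq (hC : (interior (convexSupport P)).Nonempty)
    {u : EuclideanSpace ℝ (Fin d)} {c : ℝ} (h : ∀ᵐ x ∂P, ⟪x, u⟫_ℝ = c) : u = 0 := by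
  have hcl : IsClosed {x : EuclideanSpace ℝ (Fin d) | ⟪x, u⟫_ℝ = c} :=
    isClosed_eq (by fun_prop) continuous_const
  have hconv : Convex ℝ {x : EuclideanSpace ℝ (Fin d) | ⟪x, u⟫_ℝ = c} := by
    simp_rw [real_inner_comm u]
    exact convex_hyperplane (innerₗ _ u).isLinear c
  have hsub : convexSupport P ⊆ {x | ⟪x, u⟫_ℝ = c} :=
    closure_minimal (convexHull_min (Measure.support_subset_of_isClosed hcl h) hconv) hcl
  obtain ⟨x, hx⟩ := hC
  have hx' := hsub (interior_subset hx)
  have hc : ContinuousAt (fun t : ℝ => x + t • u) 0 := by fun_prop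
  have hev : ∀ᶠ t : ℝ in 𝓝[>] 0, x + t • u ∈ convexSupport P :=
    nhdsWithin_le_nhds (hc.preimage_mem_nhds (by simpa using mem_interior_iff_mem_nhds.1 hx))
  obtain ⟨t, ht, htpos⟩ := (hev.and self_mem_nhdsWithin).exists
  have ht' := hsub ht
  simp only [mem_ofPred_eq, inner_add_left, inner_smul_left] at ht' hx'
  have h0 : t * ⟪u, u⟫_ℝ = 0 := by simpa [hx'] using ht'
  exact inner_self_eq_zero.1 ((mul_eq_zero.1 h0).resolve_left (ne_of_gt htpos))

/-- Every direction is charged by a full-dimensional measure around an interior point. -/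
lemma exists_measure_pos_of_mem_interior (hy : y ∈ interior (convexSupport P))
    {u : EuclideanSpace ℝ (Fin d)} (hu : u ≠ 0) : ¬ ∀ᵐ x ∂P, ⟪x - y, u⟫_ℝ ≤ 0 := by
  intro h
  have hcl : IsClosed {x : EuclideanSpace ℝ (Fin d) | ⟪x, u⟫_ℝ ≤ ⟪y, u⟫_ℝ} :=
    isClosed_le (by fun_prop) continuous_const
  have hconv : Convex ℝ {x : EuclideanSpace ℝ (Fin d) | ⟪x, u⟫_ℝ ≤ ⟪y, u⟫_ℝ} := by
    simp_rw [real_inner_comm u]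
    exact convex_halfSpace_le (innerₗ _ u).isLinear _
  have hsub : convexSupport P ⊆ {x | ⟪x, u⟫_ℝ ≤ ⟪y, u⟫_ℝ} := by
    refine closure_minimal (convexHull_min (Measure.support_subset_of_isClosed hcl ?_) hconv) hcl
    filter_upwards [h] with x hx
    simpa [inner_sub_left] using hx
  have hc : ContinuousAt (fun t : ℝ => y + t • u) 0 := by fun_prop
  have hev : ∀ᶠ t : ℝ in 𝓝[>] 0, y + t • u ∈ convexSupport P :=
    nhdsWithin_le_nhds (hc.preimage_mem_nhds (by simpa using mem_interior_iff_mem_nhds.1 hy))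
  obtain ⟨t, ht, htpos⟩ := (hev.and self_mem_nhdsWithin).exists
  have ht' := hsub ht
  simp only [mem_ofPred_eq, inner_add_left, inner_smul_left, conj_trivial] at ht'
  have : 0 < t * ⟪u, u⟫_ℝ := mul_pos htpos (real_inner_self_pos.2 hu)
  linarith

/-- The mean of a measure equivalent to a full-dimensional one is interior to the convex
support. -/
lemma mem_interior_convexSupport_of_hasMean [IsProbabilityMeasure Q]
    (hC : (interior (convexSupport P)).Nonempty) (hac : Q ≪ P) (hac' : P ≪ Q)
    (hQ : HasMean Q y) : y ∈ interior (convexSupport P) := by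
  by_contra hy
  obtain ⟨f, hf⟩ := geometric_hahn_banach_open_point convex_convexSupport.interior
    isOpen_interior hy
  have hle : ∀ x ∈ convexSupport P, f x ≤ f y := by
    intro x hx
    have : x ∈ closure (interior (convexSupport P)) := by
      rwa [convex_convexSupport.closure_interior_eq_closure_of_nonempty_interior hC,
        isClosed_convexSupport.closure_eq]
    exact closure_minimal (fun z hz => (hf z hz).le) (isClosed_le f.continuous continuous_const) this
  have hfi : Integrable (fun x => f x) Q := f.integrable_comp hQ.1
  have hmean : ∫ x, f x ∂Q = f y := by rw [f.integral_comp_comm hQ.1, hQ.2]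
  -- A nonnegative function with zero integral vanishes a.e., so `P` would sit on a hyperplane.
  have hnn : 0 ≤ᵐ[Q] fun x => f y - f x := by
    filter_upwards [hac.ae_le ae_mem_convexSupport] with x hx
    simpa using hle x hx
  have hz := (integral_eq_zero_iff_of_nonneg_ae hnn ((integrable_const _).sub hfi)).1
    (by rw [integral_sub (integrable_const _) hfi, hmean]; simp)
  have hP : ∀ᵐ x ∂P, ⟪x, (InnerProductSpace.toDual ℝ _).symm f⟫_ℝ = f y := by
    filter_upwards [hac'.ae_le hz] with x hx
    rw [real_inner_comm, InnerProductSpace.toDual_symm_apply]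
    simp only [Pi.zero_apply] at hx
    linarith
  have hf0 : f = 0 := by simpa using eq_zero_of_ae_inner_eq hC hP
  obtain ⟨x, hx⟩ := hC
  simpa [hf0] using hf x hx

lemma meanParam_mem_interior [IsProbabilityMeasure P]
    (hC : (interior (convexSupport P)).Nonempty) (hθ : θ ∈ interior (naturalSpace P)) :
    meanParam P θ ∈ interior (convexSupport P) :=
  have := isProbabilityMeasure_expFamily (interior_subset hθ)
  mem_interior_convexSupport_of_hasMean hC expFamily_absolutelyContinuous
    (absolutelyContinuous_expFamily (interior_subset hθ)) ⟨integrable_id_expFamily hθ, rfl⟩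

/-- The mean parametrization of a minimal exponential family is injective. -/
lemma meanParam_injOn [IsProbabilityMeasure P] (hC : (interior (convexSupport P)).Nonempty) :
    InjOn (meanParam P) (interior (naturalSpace P)) := by
  intro θ hθ η hη h
  have hθ' := interior_subset hθ
  have hη' := interior_subset hη
  have := isProbabilityMeasure_expFamily hθ'
  have := isProbabilityMeasure_expFamily hη'
  have hi := integrable_id_expFamily hθ
  have hj := integrable_id_expFamily hη
  -- Added together, the two identities say that the symmetrized divergence is `⟪meanParam P θ -
  -- meanParam P η, θ - η⟫`, which is zero here.
  have h1 := toReal_klDiv_eq_add hη' ⟨hi, rfl⟩ (klDiv_expFamily_ne_top hθ' hi)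
  have h2 := toReal_klDiv_eq_add hθ' ⟨hj, rfl⟩ (klDiv_expFamily_ne_top hη' hj)
  change _ = ⟪meanParam P θ, η⟫_ℝ - _ + _ at h1
  change _ = ⟪meanParam P η, θ⟫_ℝ - _ + _ at h2
  rw [toReal_klDiv_expFamily hθ' hi] at h1
  rw [toReal_klDiv_expFamily hη' hj] at h2
  rw [← h] at h2
  have hnn := ENNReal.toReal_nonneg (a := InformationTheory.klDiv (expFamily P η) (expFamily P θ))
  have hnn' := ENNReal.toReal_nonneg (a := InformationTheory.klDiv (expFamily P θ) (expFamily P η))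
  have hz : (InformationTheory.klDiv (expFamily P θ) (expFamily P η)).toReal = 0 := by linarith
  -- Needed because `toReal` also vanishes at `⊤`.
  have hkl : InformationTheory.klDiv (expFamily P θ) (expFamily P η) ≠ ⊤ := by
    refine InformationTheory.klDiv_ne_top
      (expFamily_absolutelyContinuous.trans (absolutelyContinuous_expFamily hη')) ?_
    exact integrable_llr_tilted_right expFamily_absolutelyContinuous (hi.inner_const η)
      (InformationTheory.klDiv_ne_top_iff.1 (klDiv_expFamily_ne_top hθ' hi)).2
      (mem_naturalSpace_iff.1 hη')
  have heq : expFamily P θ = expFamily P η :=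
    InformationTheory.klDiv_eq_zero_iff.1 ((ENNReal.toReal_eq_zero_iff _).1 hz |>.resolve_right hkl)
  -- Equal members have equal log-densities, so `⟪x, θ - η⟫` is a.e. constant.
  have e1 := log_rnDeriv_tilted_left_self (mem_naturalSpace_iff.1 hθ')
  have e2 := log_rnDeriv_tilted_left_self (mem_naturalSpace_iff.1 hη')
  rw [← expFamily] at e1 e2
  rw [heq] at e1
  have : θ - η = 0 := by
    refine eq_zero_of_ae_inner_eq hC (c := psi P θ - psi P η) ?_
    filter_upwards [e1, e2] with x h1 h2
    rw [h1] at h2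
    rw [inner_sub_right, psi, psi]
    linarith
  exact sub_eq_zero.1 this

end ExponentialFamily

/-- Pointwise convexity of `klFun` in the density; its nonnegativity allows lower integrals, so no
integrability is required. -/
lemma klDiv_smul_add_smul_le {α : Type*} {mα : MeasurableSpace α} {P Q₁ Q₂ : Measure α}
    [IsFiniteMeasure P] [IsFiniteMeasure Q₁] [IsFiniteMeasure Q₂] {a b : ℝ≥0} (hab : a + b = 1)
    (h₁ : Q₁ ≪ P) (h₂ : Q₂ ≪ P) :
    InformationTheory.klDiv (a • Q₁ + b • Q₂) P ≤
      a * InformationTheory.klDiv Q₁ P + b * InformationTheory.klDiv Q₂ P := by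
  have hac : a • Q₁ + b • Q₂ ≪ P :=
    (h₁.smul_left a).add_left (h₂.smul_left b)
  rw [InformationTheory.klDiv_eq_lintegral_klFun_of_ac hac,
    InformationTheory.klDiv_eq_lintegral_klFun_of_ac h₁,
    InformationTheory.klDiv_eq_lintegral_klFun_of_ac h₂,
    ← lintegral_const_mul _ (by fun_prop), ← lintegral_const_mul _ (by fun_prop),
    ← lintegral_add_left (by fun_prop)]
  refine lintegral_mono_ae ?_
  filter_upwards [Measure.rnDeriv_add (a • Q₁) (b • Q₂) P, Measure.rnDeriv_smul_left Q₁ P a,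
    Measure.rnDeriv_smul_left Q₂ P b, Measure.rnDeriv_lt_top Q₁ P,
    Measure.rnDeriv_lt_top Q₂ P] with x h h1 h2 ht1 ht2
  have hx : ((a • Q₁ + b • Q₂).rnDeriv P x).toReal =
      (a : ℝ) • (Q₁.rnDeriv P x).toReal + (b : ℝ) • (Q₂.rnDeriv P x).toReal := by
    rw [h, Pi.add_apply, h1, h2, Pi.smul_apply, Pi.smul_apply, ENNReal.smul_def, ENNReal.smul_def,
      smul_eq_mul, smul_eq_mul, ENNReal.toReal_add (ENNReal.mul_ne_top (by simp) ht1.ne)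
        (ENNReal.mul_ne_top (by simp) ht2.ne)]
    simp
  have hnn (Q : Measure α) : 0 ≤ InformationTheory.klFun (Q.rnDeriv P x).toReal :=
    InformationTheory.klFun_nonneg ENNReal.toReal_nonneg
  have hc := InformationTheory.convexOn_klFun.2 (x := (Q₁.rnDeriv P x).toReal)
    (y := (Q₂.rnDeriv P x).toReal) ENNReal.toReal_nonneg ENNReal.toReal_nonneg
    a.coe_nonneg b.coe_nonneg (by exact_mod_cast hab)
  calc ENNReal.ofReal (InformationTheory.klFun ((a • Q₁ + b • Q₂).rnDeriv P x).toReal)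
      ≤ ENNReal.ofReal ((a : ℝ) * InformationTheory.klFun (Q₁.rnDeriv P x).toReal +
          (b : ℝ) * InformationTheory.klFun (Q₂.rnDeriv P x).toReal) := by
        rw [hx]
        exact ENNReal.ofReal_le_ofReal hc
    _ = _ := by
        rw [ENNReal.ofReal_add (mul_nonneg a.coe_nonneg (hnn Q₁)) (mul_nonneg b.coe_nonneg (hnn Q₂)),
          ENNReal.ofReal_mul a.coe_nonneg, ENNReal.ofReal_mul b.coe_nonneg, ENNReal.ofReal_coe_nnreal,
          ENNReal.ofReal_coe_nnreal]

/-! ### Duality bound, domain and convexity of the MEM function. -/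

section MemFunction

variable {d : ℕ} {ν P : Measure (EuclideanSpace ℝ (Fin d))} {θ y : EuclideanSpace ℝ (Fin d)}

lemma memFunction_lt_iff {c : EReal} : memFunction ν P y < c ↔
    ∃ Q, Q ∈ distributions ν ∧ HasMean Q y ∧ (InformationTheory.klDiv Q P : EReal) < c := by
  simp [memFunction, iInf_lt_iff, and_assoc]

lemma memFunction_le {Q : Measure (EuclideanSpace ℝ (Fin d))} (hQ : Q ∈ distributions ν)
    (hy : HasMean Q y) : memFunction ν P y ≤ InformationTheory.klDiv Q P :=
  iInf₂_le (f := fun Q (_ : Q ∈ {Q | Q ∈ distributions ν ∧ HasMean Q y}) =>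
    (InformationTheory.klDiv Q P : EReal)) Q ⟨hQ, hy⟩

lemma memFunction_nonneg : 0 ≤ memFunction ν P y :=
  le_iInf₂ fun _ _ => EReal.coe_ennreal_nonneg _

/-- Drop the nonnegative remainder in the Pythagorean identity. -/
lemma le_memFunction [IsProbabilityMeasure P] (hθ : θ ∈ naturalSpace P) :
    ((⟪y, θ⟫_ℝ - psi P θ : ℝ) : EReal) ≤ memFunction ν P y := by
  refine le_iInf₂ fun Q hQ => ?_
  have := hQ.1.1
  by_cases hkl : InformationTheory.klDiv Q P = ⊤
  · simp [hkl]
  · have h := toReal_klDiv_eq_add hθ hQ.2 hkl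
    rw [← EReal.coe_ennreal_toReal hkl, EReal.coe_le_coe_iff, h]
    linarith [ENNReal.toReal_nonneg (a := InformationTheory.klDiv Q (expFamily P θ))]

/-- On the range of the mean parametrization the infimum is attained by the exponential family. -/
lemma memFunction_meanParam [IsProbabilityMeasure P] (hν : P ≪ ν)
    (hθ : θ ∈ interior (naturalSpace P)) :
    memFunction ν P (meanParam P θ) = ((⟪meanParam P θ, θ⟫_ℝ - psi P θ : ℝ) : EReal) := by
  have hθ' := interior_subset hθ
  have hi := integrable_id_expFamily hθ
  refine le_antisymm ?_ (le_memFunction hθ')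
  refine (memFunction_le (P := P) ⟨isProbabilityMeasure_expFamily hθ',
    expFamily_absolutelyContinuous.trans hν⟩ ⟨hi, rfl⟩).trans_eq ?_
  rw [← toReal_klDiv_expFamily hθ' hi, EReal.coe_ennreal_toReal (klDiv_expFamily_ne_top hθ' hi)]

lemma dom_memFunction_subset : dom (memFunction ν P) ⊆ convexSupport P := by
  intro y hy
  obtain ⟨Q, hQ, hQy, hlt⟩ := memFunction_lt_iff.1 hy
  have := hQ.1
  refine mem_convexSupport_of_hasMean (InformationTheory.klDiv_ne_top_iff.1 ?_).1 hQy
  rintro h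
  simp [h] at hlt

lemma isConvex_memFunction [IsProbabilityMeasure P] : IsConvex (memFunction ν P) := by
  rintro ⟨y₁, r₁⟩ h₁ ⟨y₂, r₂⟩ h₂ a b ha hb hab
  simp only [mem_ofPred_eq, Prod.smul_mk, Prod.mk_add_mk, smul_eq_mul] at h₁ h₂ ⊢
  lift a to ℝ≥0 using ha
  lift b to ℝ≥0 using hb
  have hab' : a + b = 1 := by exact_mod_cast hab
  -- The infimum need not be attained, so near-minimizers with slack `ε` are mixed.
  refine EReal.le_of_forall_lt_iff_le.1 fun z hz => ?_
  rw [EReal.coe_lt_coe_iff] at hz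
  obtain ⟨ε, hε, rfl⟩ : ∃ ε > 0, a * r₁ + b * r₂ + ε = z := ⟨z - (a * r₁ + b * r₂), by linarith,
    by ring⟩
  obtain ⟨Q₁, hQ₁, hy₁, hk₁⟩ := memFunction_lt_iff.1
    (h₁.trans_lt (EReal.coe_lt_coe_iff.2 (lt_add_of_pos_right r₁ hε)))
  obtain ⟨Q₂, hQ₂, hy₂, hk₂⟩ := memFunction_lt_iff.1
    (h₂.trans_lt (EReal.coe_lt_coe_iff.2 (lt_add_of_pos_right r₂ hε)))
  have := hQ₁.1
  have := hQ₂.1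
  have ht₁ : InformationTheory.klDiv Q₁ P ≠ ⊤ := by rintro h; simp [h] at hk₁
  have ht₂ : InformationTheory.klDiv Q₂ P ≠ ⊤ := by rintro h; simp [h] at hk₂
  have hprob : IsProbabilityMeasure (a • Q₁ + b • Q₂) := ⟨by
    simp only [Measure.coe_add, Pi.add_apply, Measure.coe_nnreal_smul_apply, measure_univ, mul_one]
    exact_mod_cast hab'⟩
  have hi₁ : Integrable (fun x => x) (a • Q₁) := hy₁.1.smul_measure_nnreal
  have hi₂ : Integrable (fun x => x) (b • Q₂) := hy₂.1.smul_measure_nnreal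
  have hmean : HasMean (a • Q₁ + b • Q₂) ((a : ℝ) • y₁ + (b : ℝ) • y₂) := by
    refine ⟨hi₁.add_measure hi₂, ?_⟩
    rw [integral_add_measure hi₁ hi₂, integral_smul_nnreal_measure, integral_smul_nnreal_measure,
      hy₁.2, hy₂.2]
    rfl
  refine (memFunction_le ⟨hprob, (hQ₁.2.smul_left a).add_left (hQ₂.2.smul_left b)⟩ hmean).trans ?_
  have hle := klDiv_smul_add_smul_le hab' (InformationTheory.klDiv_ne_top_iff.1 ht₁).1
    (InformationTheory.klDiv_ne_top_iff.1 ht₂).1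
  refine (EReal.coe_ennreal_le_coe_ennreal_iff.2 hle).trans ?_
  rw [← EReal.coe_ennreal_toReal ht₁, EReal.coe_lt_coe_iff] at hk₁
  rw [← EReal.coe_ennreal_toReal ht₂, EReal.coe_lt_coe_iff] at hk₂
  have hne : (a : ℝ≥0∞) * InformationTheory.klDiv Q₁ P + b * InformationTheory.klDiv Q₂ P ≠ ⊤ :=
    ENNReal.add_ne_top.2 ⟨ENNReal.mul_ne_top (by simp) ht₁, ENNReal.mul_ne_top (by simp) ht₂⟩
  rw [← EReal.coe_ennreal_toReal hne, EReal.coe_le_coe_iff,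
    ENNReal.toReal_add (ENNReal.mul_ne_top (by simp) ht₁) (ENNReal.mul_ne_top (by simp) ht₂),
    ENNReal.toReal_mul, ENNReal.toReal_mul, ENNReal.coe_toReal, ENNReal.coe_toReal]
  have h1 := mul_le_mul_of_nonneg_left hk₁.le a.coe_nonneg
  have h2 := mul_le_mul_of_nonneg_left hk₂.le b.coe_nonneg
  have : ε = a * ε + b * ε := by rw [← add_mul, hab, one_mul]
  linarith

end MemFunction

/-! ### Steepness and surjectivity of the mean map. -/

section Steep

variable {d : ℕ} {P : Measure (EuclideanSpace ℝ (Fin d))} {θ η y : EuclideanSpace ℝ (Fin d)}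

lemma IsSteepFamily.differentiableAt_psi (h : IsSteepFamily P)
    (hθ : θ ∈ interior (naturalSpace P)) : DifferentiableAt ℝ (psi P) θ := by
  have := h.differentiable θ (by rwa [dom_logNormalizer])
  simpa only [toReal_logNormalizer] using this

lemma IsSteepFamily.hasGradientAt_psi [IsProbabilityMeasure P] (h : IsSteepFamily P)
    (hθ : θ ∈ interior (naturalSpace P)) : HasGradientAt (psi P) (meanParam P θ) θ :=
  MEM.hasGradientAt_psi hθ (h.differentiableAt_psi hθ)

lemma IsSteepFamily.tendsto_norm_meanParam [IsProbabilityMeasure P] (h : IsSteepFamily P)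
    {u : ℕ → EuclideanSpace ℝ (Fin d)} (hθ : θ ∈ frontier (naturalSpace P))
    (hu : ∀ k, u k ∈ interior (naturalSpace P)) (hlim : Tendsto u atTop (𝓝 θ)) :
    Tendsto (fun k => ‖meanParam P (u k)‖) atTop atTop := by
  have := h.steep θ u (by rwa [dom_logNormalizer]) (by simpa [dom_logNormalizer] using hu) hlim
  simp only [toReal_logNormalizer] at this
  refine this.congr fun k => ?_
  rw [(h.hasGradientAt_psi (hu k)).gradient]

lemma convex_naturalSpace : Convex ℝ (naturalSpace P) := by
  intro θ hθ η hη a b ha hb hab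
  rw [mem_naturalSpace_iff] at *
  refine ((hθ.const_mul a).add (hη.const_mul b)).mono'
    (by fun_prop : Continuous fun x : EuclideanSpace ℝ (Fin d) =>
      Real.exp ⟪x, a • θ + b • η⟫_ℝ).aestronglyMeasurable (ae_of_all _ fun x => ?_)
  have := convexOn_exp.2 (mem_univ ⟪x, θ⟫_ℝ) (mem_univ ⟪x, η⟫_ℝ) ha hb hab
  simpa [inner_add_right, inner_smul_right] using this

/-- The subgradient inequality for the log-normalizer. -/
lemma psi_add_inner_le [IsProbabilityMeasure P] (hθ : θ ∈ interior (naturalSpace P))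
    (hη : η ∈ naturalSpace P) : psi P θ + ⟪meanParam P θ, η - θ⟫_ℝ ≤ psi P η := by
  have hi := integrable_id_expFamily hθ
  have hθ' := interior_subset hθ
  have := isProbabilityMeasure_expFamily hθ'
  have h := toReal_klDiv_eq_add hη ⟨hi, rfl⟩ (klDiv_expFamily_ne_top hθ' hi)
  change _ = ⟪meanParam P θ, η⟫_ℝ - _ + _ at h
  rw [toReal_klDiv_expFamily hθ' hi] at h
  rw [inner_sub_right]
  linarith [ENNReal.toReal_nonneg
    (a := InformationTheory.klDiv (expFamily P θ) (expFamily P η))]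

/-- First-order optimality: a minimizer of `ψ - ⟪y, ·⟫` has mean parameter `y`. -/
lemma IsSteepFamily.meanParam_eq [IsProbabilityMeasure P] (h : IsSteepFamily P)
    (hθ : θ ∈ interior (naturalSpace P))
    (hmin : ∀ η ∈ interior (naturalSpace P), psi P θ + ⟪y, η - θ⟫_ℝ ≤ psi P η) :
    meanParam P θ = y := by
  have hd : HasFDerivAt (fun η => psi P η - ⟪y, η⟫_ℝ)
      (InnerProductSpace.toDual ℝ _ (meanParam P θ) - innerSL ℝ y) θ :=
    (h.hasGradientAt_psi hθ).hasFDerivAt.sub (innerSL ℝ y).hasFDerivAt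
  have hloc : IsLocalMin (fun η => psi P η - ⟪y, η⟫_ℝ) θ := by
    filter_upwards [isOpen_interior.mem_nhds hθ] with η hη
    have := hmin η hη
    rw [inner_sub_right] at this
    linarith
  have h0 := hloc.hasFDerivAt_eq_zero hd
  refine ext_inner_right ℝ fun v => ?_
  have hv := DFunLike.congr_fun h0 v
  simp only [_root_.sub_apply, InnerProductSpace.toDual_apply_apply,
    innerSL_apply_apply, _root_.zero_apply] at hv
  linarith

/-- The strict subgradient inequality for the log-normalizer. -/
lemma IsSteepFamily.psi_add_inner_lt [IsProbabilityMeasure P] (h : IsSteepFamily P)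
    (hθ : θ ∈ interior (naturalSpace P)) (hη : η ∈ interior (naturalSpace P))
    (hne : meanParam P θ ≠ meanParam P η) :
    psi P θ + ⟪meanParam P θ, η - θ⟫_ℝ < psi P η := by
  -- Equality would make `η` a second minimizer of `ψ - ⟪meanParam P θ, ·⟫`.
  refine (psi_add_inner_le hθ (interior_subset hη)).lt_of_ne fun heq => hne ?_
  refine (h.meanParam_eq hη fun ζ hζ => ?_).symm
  have := psi_add_inner_le hθ (interior_subset hζ)
  rw [inner_sub_right] at *
  linarith

/-- Convergence of the mean parameters forces limits of natural parameters to be interior. -/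
lemma IsSteepFamily.mem_interior_of_tendsto [IsProbabilityMeasure P] (h : IsSteepFamily P)
    {u : ℕ → EuclideanSpace ℝ (Fin d)} (hu : ∀ k, u k ∈ interior (naturalSpace P))
    (hlim : Tendsto u atTop (𝓝 θ)) (hm : Tendsto (fun k => meanParam P (u k)) atTop (𝓝 y)) :
    θ ∈ interior (naturalSpace P) ∧ meanParam P θ = y := by
  have hθ : θ ∈ interior (naturalSpace P) := by
    by_contra hθ
    exact not_tendsto_nhds_of_tendsto_atTop (h.tendsto_norm_meanParam
      ⟨mem_closure_of_tendsto hlim (Eventually.of_forall fun k => interior_subset (hu k)), hθ⟩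
      hu hlim) _ hm.norm
  refine ⟨hθ, h.meanParam_eq hθ fun η hη => ?_⟩
  have hc : Tendsto (fun k => psi P (u k)) atTop (𝓝 (psi P θ)) :=
    (h.differentiableAt_psi hθ).continuousAt.tendsto.comp hlim
  exact le_of_tendsto (hc.add (hm.inner (tendsto_const_nhds.sub hlim)))
    (Eventually.of_forall fun k => psi_add_inner_le (hu k) (interior_subset hη))

lemma IsSteepFamily.exists_psi_le [IsProbabilityMeasure P] (h : IsSteepFamily P) {r : ℝ}
    (hr : Metric.closedBall 0 r ⊆ interior (naturalSpace P)) :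
    ∃ K, ∀ θ ∈ Metric.closedBall (0 : EuclideanSpace ℝ (Fin d)) r, psi P θ ≤ K := by
  have hc : ContinuousOn (psi P) (Metric.closedBall 0 r) := fun θ hθ =>
    (h.differentiableAt_psi (hr hθ)).continuousAt.continuousWithinAt
  obtain ⟨K, hK⟩ := ((isCompact_closedBall 0 r).image_of_continuousOn hc).bddAbove
  exact ⟨K, fun θ hθ => hK (mem_image_of_mem _ hθ)⟩

/-- The moment generating function of `P` recentred at `y`. -/
noncomputable def centredMomentGen (P : Measure (EuclideanSpace ℝ (Fin d)))
    (y θ : EuclideanSpace ℝ (Fin d)) : ℝ≥0∞ :=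
  ∫⁻ x, ENNReal.ofReal (Real.exp ⟪x - y, θ⟫_ℝ) ∂P

lemma centredMomentGen_eq :
    centredMomentGen P y θ = momentGen P θ * ENNReal.ofReal (Real.exp (-⟪y, θ⟫_ℝ)) := by
  rw [centredMomentGen, momentGen, ← lintegral_mul_const _ (by fun_prop)]
  refine lintegral_congr fun x => ?_
  rw [← ENNReal.ofReal_mul (Real.exp_pos _).le, ← Real.exp_add, inner_sub_left, sub_eq_add_neg]

lemma centredMomentGen_eq_ofReal [IsProbabilityMeasure P] (hθ : θ ∈ naturalSpace P) :
    centredMomentGen P y θ = ENNReal.ofReal (Real.exp (psi P θ - ⟪y, θ⟫_ℝ)) := by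
  rw [centredMomentGen_eq, momentGen_eq_ofReal hθ, sub_eq_add_neg, Real.exp_add, psi,
    Real.exp_log (integral_exp_inner_pos hθ), ENNReal.ofReal_mul (integral_exp_inner_pos hθ).le]

lemma mem_naturalSpace_of_centredMomentGen_lt_top (h : centredMomentGen P y θ < ⊤) :
    θ ∈ naturalSpace P := by
  rw [centredMomentGen_eq] at h
  by_contra hθ
  have ht : momentGen P θ = ⊤ := by simpa [naturalSpace] using hθ
  rw [ht, ENNReal.top_mul (by simp [Real.exp_pos])] at h
  exact lt_irrefl _ h

/-- Fatou's lemma along `𝓝 θ`; the value `⊤` outside `Θ_P` is what makes this hold globally. -/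
lemma lowerSemicontinuous_centredMomentGen : LowerSemicontinuous (centredMomentGen P y) := by
  refine lowerSemicontinuous_iff_le_liminf.2 fun θ => ?_
  refine le_trans (le_of_eq ?_) (lintegral_liminf_le (u := 𝓝 θ)
    (f := fun η x => ENNReal.ofReal (Real.exp ⟪x - y, η⟫_ℝ)) fun η => by fun_prop)
  refine lintegral_congr fun x => ?_
  have hc : Continuous fun η => ENNReal.ofReal (Real.exp ⟪x - y, η⟫_ℝ) :=
    ENNReal.continuous_ofReal.comp (by fun_prop)
  exact ((hc.tendsto θ).liminf_eq).symm

/-- If the parameters escape along a limiting direction `u`, the integrand tends to `⊤` wherever `⟪x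
- y, u⟫ > 0`. By Fatou that set is null, so `P` lies in a half-space with `y` on its boundary, which
is impossible for interior `y`. -/
lemma isBounded_centredMomentGen_le_one (hy : y ∈ interior (convexSupport P)) :
    Bornology.IsBounded {θ | centredMomentGen P y θ ≤ 1} := by
  by_contra hb
  have hex : ∀ k : ℕ, ∃ θ, centredMomentGen P y θ ≤ 1 ∧ (k : ℝ) < ‖θ‖ := by
    intro k
    by_contra! hk
    exact hb (isBounded_iff_forall_norm_le.2 ⟨k, fun θ hθ => hk θ hθ⟩)
  choose w hw hwk using hex
  have hpos : ∀ k, 0 < ‖w k‖ := fun k => (Nat.cast_nonneg k).trans_lt (hwk k)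
  have hsph : ∀ k, (‖w k‖⁻¹ • w k) ∈ Metric.sphere (0 : EuclideanSpace ℝ (Fin d)) 1 := fun k => by
    simp [norm_smul, (hpos k).ne']
  obtain ⟨u, hu, φ, hφ, hlim⟩ := (isCompact_sphere _ _).tendsto_subseq hsph
  have hu0 : u ≠ 0 := by
    rintro rfl
    simp at hu
  have hnorm : Tendsto (fun k => ‖w (φ k)‖) atTop atTop :=
    tendsto_atTop_mono (fun k => (hwk (φ k)).le)
      (tendsto_natCast_atTop_atTop.comp hφ.tendsto_atTop)
  have hfatou := lintegral_liminf_le (μ := P) (u := atTop)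
    (f := fun k x => ENNReal.ofReal (Real.exp ⟪x - y, w (φ k)⟫_ℝ)) fun k => by fun_prop
  have hle : liminf (fun k => centredMomentGen P y (w (φ k))) atTop ≤ 1 :=
    (liminf_le_liminf (Eventually.of_forall fun k => hw (φ k))).trans (by simp)
  have hfin := (hfatou.trans hle).trans_lt ENNReal.one_lt_top
  have hae := ae_lt_top (.liminf fun k => by fun_prop) hfin.ne
  refine exists_measure_pos_of_mem_interior hy hu0 ?_
  filter_upwards [hae] with x hx
  by_contra! hxu
  refine hx.ne (Tendsto.liminf_eq ?_)
  refine ENNReal.tendsto_ofReal_nhds_top.2 (Real.tendsto_exp_atTop.comp ?_)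
  have hin : Tendsto (fun k => ⟪x - y, ‖w (φ k)‖⁻¹ • w (φ k)⟫_ℝ) atTop (𝓝 ⟪x - y, u⟫_ℝ) :=
    tendsto_const_nhds.inner hlim
  refine (hnorm.atTop_mul_pos hxu hin).congr fun k => ?_
  rw [inner_smul_right, mul_inv_cancel_left₀ (hpos _).ne']

/-- The mean parametrization of a steep family covers the interior of the convex support. -/
lemma IsSteepFamily.exists_meanParam_eq [IsProbabilityMeasure P] (h : IsSteepFamily P)
    (hzero : 0 ∈ interior (naturalSpace P)) (hy : y ∈ interior (convexSupport P)) :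
    ∃ θ ∈ interior (naturalSpace P), meanParam P θ = y := by
  -- Level `1` is the value at `0`, so this compact sublevel set is nonempty and holds a global
  -- minimizer.
  have hcpt : IsCompact {θ | centredMomentGen P y θ ≤ 1} :=
    Metric.isCompact_of_isClosed_isBounded
      (lowerSemicontinuous_centredMomentGen.isClosed_preimage 1)
      (isBounded_centredMomentGen_le_one hy)
  obtain ⟨θ, hθ1, hθmin⟩ := LowerSemicontinuousOn.exists_isMinOn
    ⟨0, by simp [centredMomentGen]⟩ hcpt
    (lowerSemicontinuous_centredMomentGen.lowerSemicontinuousOn _)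
  have hθ : θ ∈ naturalSpace P :=
    mem_naturalSpace_of_centredMomentGen_lt_top (hθ1.trans_lt ENNReal.one_lt_top)
  have hmin : ∀ η ∈ naturalSpace P, psi P θ + ⟪y, η - θ⟫_ℝ ≤ psi P η := by
    intro η hη
    have hle : centredMomentGen P y θ ≤ centredMomentGen P y η := by
      rcases le_or_gt (centredMomentGen P y η) 1 with h1 | h1
      · exact hθmin h1
      · exact hθ1.trans h1.le
    rw [centredMomentGen_eq_ofReal hθ, centredMomentGen_eq_ofReal hη,
      ENNReal.ofReal_le_ofReal_iff (Real.exp_pos _).le, Real.exp_le_exp] at hle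
    rw [inner_sub_right]
    linarith
  suffices hint : θ ∈ interior (naturalSpace P) from
    ⟨θ, hint, h.meanParam_eq hint fun η hη => hmin η (interior_subset hη)⟩
  by_contra hint
  obtain ⟨r, hr, hball⟩ := Metric.nhds_basis_closedBall.mem_iff.1 (isOpen_interior.mem_nhds hzero)
  obtain ⟨K, hK⟩ := h.exists_psi_le hball
  have htend : Tendsto (fun k : ℕ => 1 / ((k : ℝ) + 1)) atTop (𝓝 0) :=
    tendsto_one_div_add_atTop_nhds_zero_nat
  have hu : ∀ k : ℕ, (1 - 1 / ((k : ℝ) + 1)) • θ ∈ interior (naturalSpace P) := by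
    intro k
    have hk : 1 / ((k : ℝ) + 1) ≤ 1 := by
      rw [div_le_one (by positivity)]
      linarith [Nat.cast_nonneg (α := ℝ) k]
    simpa using convex_naturalSpace.combo_interior_self_mem_interior hzero hθ
      (by positivity : 0 < 1 / ((k : ℝ) + 1)) (sub_nonneg.2 hk) (by ring)
  have hlim : Tendsto (fun k : ℕ => (1 - 1 / ((k : ℝ) + 1)) • θ) atTop (𝓝 θ) := by
    simpa using (htend.const_sub 1).smul_const θ
  have hinf := h.tendsto_norm_meanParam ⟨subset_closure hθ, hint⟩ hu hlim
  -- Along the segment from `0` to a boundary minimizer the means `v` blow up. But minimality and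
  -- the subgradient inequality at `θ` give `⟪v, θ⟫ ≤ ⟪y, θ⟫`, and the subgradient inequality at a
  -- point of the ball then gives `r * ‖v‖ ≤ K - ψ(θ) + ⟪y, θ⟫`.
  obtain ⟨k, hk⟩ := (hinf.eventually_gt_atTop ((K - psi P θ + ⟪y, θ⟫_ℝ) / r)).exists
  rw [div_lt_iff₀ hr] at hk
  set s : ℝ := 1 / ((k : ℝ) + 1) with hs
  have hspos : 0 < s := by positivity
  have hs1 : s ≤ 1 := by
    rw [hs, div_le_one (by positivity)]
    linarith [Nat.cast_nonneg (α := ℝ) k]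
  set v := meanParam P ((1 - s) • θ)
  have h1 := psi_add_inner_le (hu k) hθ
  have h2 := hmin _ (interior_subset (hu k))
  -- The test point in direction `v`, whose pairing with `v` is `r * ‖v‖`; it is `0` when `v = 0`.
  have hmem : r • (‖v‖⁻¹ • v) ∈ Metric.closedBall (0 : EuclideanSpace ℝ (Fin d)) r := by
    rw [mem_closedBall_zero_iff, norm_smul, norm_smul, norm_inv, norm_norm, Real.norm_of_nonneg hr.le]
    exact mul_le_of_le_one_right hr.le (inv_mul_le_one)
  have h3 := (psi_add_inner_le (hu k) (interior_subset (hball hmem))).trans (hK _ hmem)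
  have hv : ⟪v, r • (‖v‖⁻¹ • v)⟫_ℝ = r * ‖v‖ := by
    rw [inner_smul_right, inner_smul_right, real_inner_self_eq_norm_mul_norm, ← mul_assoc (‖v‖⁻¹),
      inv_mul_mul_self]
  change psi P ((1 - s) • θ) + ⟪v, θ - (1 - s) • θ⟫_ℝ ≤ _ at h1
  change psi P ((1 - s) • θ) + ⟪v, _ - (1 - s) • θ⟫_ℝ ≤ _ at h3
  change _ + ⟪y, (1 - s) • θ - θ⟫_ℝ ≤ psi P ((1 - s) • θ) at h2
  simp only [inner_sub_right, hv, inner_smul_right _ θ] at h1 h2 h3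
  have h4 : ⟪v, θ⟫_ℝ ≤ ⟪y, θ⟫_ℝ := by
    refine le_of_mul_le_mul_left ?_ hspos
    linarith
  have h5 := mul_le_mul_of_nonneg_left h4 (sub_nonneg.2 hs1)
  linarith

end Steep

/-! ### Strict convexity, gradient and steepness of `κ`. -/

section Legendre

variable {d : ℕ} {ν P : Measure (EuclideanSpace ℝ (Fin d))} {θ η y : EuclideanSpace ℝ (Fin d)}

lemma toReal_memFunction_meanParam [IsProbabilityMeasure P] (hν : P ≪ ν)
    (hθ : θ ∈ interior (naturalSpace P)) :
    (memFunction ν P (meanParam P θ)).toReal = ⟪meanParam P θ, θ⟫_ℝ - psi P θ := by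
  rw [memFunction_meanParam hν hθ, EReal.toReal_coe]

/-- The domain of `κ` and the convex support have the same interior. -/
lemma IsSteepFamily.interior_dom_memFunction [IsProbabilityMeasure P] (h : IsSteepFamily P)
    (hν : P ≪ ν) (hzero : 0 ∈ interior (naturalSpace P)) :
    interior (dom (memFunction ν P)) = interior (convexSupport P) := by
  refine (interior_mono dom_memFunction_subset).antisymm (interior_maximal ?_ isOpen_interior)
  intro y hy
  obtain ⟨θ, hθ, rfl⟩ := h.exists_meanParam_eq hzero hy
  change memFunction ν P _ < ⊤
  rw [memFunction_meanParam hν hθ]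
  exact EReal.coe_lt_top _

/-- The strict subgradient inequality for `κ`. -/
lemma IsSteepFamily.memFunction_add_inner_lt [IsProbabilityMeasure P] (h : IsSteepFamily P)
    (hν : P ≪ ν) (hθ : θ ∈ interior (naturalSpace P)) (hη : η ∈ interior (naturalSpace P))
    (hne : meanParam P θ ≠ meanParam P η) :
    (memFunction ν P (meanParam P θ)).toReal + ⟪θ, meanParam P η - meanParam P θ⟫_ℝ <
      (memFunction ν P (meanParam P η)).toReal := by
  have := h.psi_add_inner_lt hη hθ hne.symm
  rw [toReal_memFunction_meanParam hν hθ, toReal_memFunction_meanParam hν hη, inner_sub_right,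
    real_inner_comm _ θ, real_inner_comm _ θ]
  rw [inner_sub_right] at this
  linarith

lemma IsSteepFamily.memFunction_add_inner_le [IsProbabilityMeasure P] (h : IsSteepFamily P)
    (hν : P ≪ ν) (hθ : θ ∈ interior (naturalSpace P)) (hη : η ∈ interior (naturalSpace P)) :
    (memFunction ν P (meanParam P θ)).toReal + ⟪θ, meanParam P η - meanParam P θ⟫_ℝ ≤
      (memFunction ν P (meanParam P η)).toReal := by
  by_cases hne : meanParam P θ = meanParam P η
  · simp [hne]
  · exact (h.memFunction_add_inner_lt hν hθ hη hne).le

lemma IsSteepFamily.strictConvexOn_memFunction [IsProbabilityMeasure P] (h : IsSteepFamily P)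
    (hν : P ≪ ν) (hzero : 0 ∈ interior (naturalSpace P)) :
    StrictConvexOn ℝ (interior (convexSupport P)) (fun y => (memFunction ν P y).toReal) := by
  refine ⟨convex_convexSupport.interior, fun x hx y hy hxy a b ha hb hab => ?_⟩
  have hz := convex_convexSupport.interior hx hy ha.le hb.le hab
  have hzx : a • x + b • y ≠ x := by
    intro he
    have : b • (y - x) = 0 := by
      rw [smul_sub, sub_eq_zero]
      have h1 : a • x + b • x = x := by rw [← add_smul, hab, one_smul]
      exact add_left_cancel (he.trans h1.symm)
    exact hxy (sub_eq_zero.1 ((smul_eq_zero.1 this).resolve_left hb.ne')).symm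
  obtain ⟨ζ, hζ, hζz⟩ := h.exists_meanParam_eq hzero hz
  obtain ⟨θ, hθ, rfl⟩ := h.exists_meanParam_eq hzero hx
  obtain ⟨η, hη, rfl⟩ := h.exists_meanParam_eq hzero hy
  -- Average the supporting inequalities at the intermediate point; strictness in one of them
  -- suffices.
  have h1 := h.memFunction_add_inner_lt hν hζ hθ (by rwa [hζz])
  have h2 := h.memFunction_add_inner_le hν hζ hη
  rw [hζz] at h1 h2
  have h1' := mul_lt_mul_of_pos_left h1 ha
  have h2' := mul_le_mul_of_nonneg_left h2 hb.le
  simp only [inner_sub_right, inner_add_right, inner_smul_right, smul_eq_mul] at h1' h2' ⊢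
  set κ := (memFunction ν P (a • meanParam P θ + b • meanParam P η)).toReal
  have e : κ = a * κ + b * κ := by rw [← add_mul, hab, one_mul]
  have e1 : a * (κ + (⟪ζ, meanParam P θ⟫_ℝ - (a * ⟪ζ, meanParam P θ⟫_ℝ + b * ⟪ζ, meanParam P η⟫_ℝ)))
      + b * (κ + (⟪ζ, meanParam P η⟫_ℝ - (a * ⟪ζ, meanParam P θ⟫_ℝ + b * ⟪ζ, meanParam P η⟫_ℝ)))
      = κ := by
    obtain rfl : a = 1 - b := by linarith
    ring
  linarith

/-- The natural parameter with a given mean. -/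
noncomputable def naturalParam (P : Measure (EuclideanSpace ℝ (Fin d))) :
    EuclideanSpace ℝ (Fin d) → EuclideanSpace ℝ (Fin d) :=
  Function.invFunOn (meanParam P) (interior (naturalSpace P))

lemma IsSteepFamily.naturalParam_mem [IsProbabilityMeasure P] (h : IsSteepFamily P)
    (hzero : 0 ∈ interior (naturalSpace P)) (hy : y ∈ interior (convexSupport P)) :
    naturalParam P y ∈ interior (naturalSpace P) :=
  Function.invFunOn_mem (h.exists_meanParam_eq hzero hy)

lemma IsSteepFamily.meanParam_naturalParam [IsProbabilityMeasure P] (h : IsSteepFamily P)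
    (hzero : 0 ∈ interior (naturalSpace P)) (hy : y ∈ interior (convexSupport P)) :
    meanParam P (naturalParam P y) = y :=
  Function.invFunOn_eq (h.exists_meanParam_eq hzero hy)

/-- The natural parameters of means close to an interior point are bounded. -/
lemma IsSteepFamily.eventually_norm_naturalParam_le [IsProbabilityMeasure P]
    (h : IsSteepFamily P) (hν : P ≪ ν) (hzero : 0 ∈ interior (naturalSpace P))
    (hy : y ∈ interior (convexSupport P)) : ∃ B, ∀ᶠ z in 𝓝 y, ‖naturalParam P z‖ ≤ B := by
  have hc : ContinuousAt (fun y => (memFunction ν P y).toReal) y :=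
    ((h.strictConvexOn_memFunction hν hzero).convexOn.continuousOn isOpen_interior).continuousAt
      (isOpen_interior.mem_nhds hy)
  set K := (memFunction ν P y).toReal + 1
  have hev : ∀ᶠ z in 𝓝 y, z ∈ interior (convexSupport P) ∧ (memFunction ν P z).toReal ≤ K :=
    (isOpen_interior.eventually_mem hy).and
      (hc.eventually_le_const (lt_add_one (memFunction ν P y).toReal))
  obtain ⟨r, hr, hball⟩ := Metric.eventually_nhds_iff_ball.1 hev
  refine ⟨K / (r / 2), ?_⟩
  filter_upwards [Metric.ball_mem_nhds y (by linarith : 0 < r / 3)] with z hz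
  have hzC := (hball z (Metric.ball_subset_ball (by linarith) hz)).1
  set τ := naturalParam P z
  -- Move from `z` in the direction of its own subgradient `τ`; `r / 3 + r / 2 < r` keeps the point
  -- in the ball where `κ ≤ K`. Since `κ ≥ 0`, this bounds `r / 2 * ‖τ‖` by `K`.
  have hw : z + (r / 2) • (‖τ‖⁻¹ • τ) ∈ Metric.ball y r := by
    rw [mem_ball_iff_norm] at hz ⊢
    have hle : ‖(r / 2) • (‖τ‖⁻¹ • τ)‖ ≤ r / 2 := by
      rw [norm_smul, norm_smul, norm_inv, norm_norm, Real.norm_of_nonneg (by linarith)]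
      exact mul_le_of_le_one_right (by linarith) inv_mul_le_one
    calc ‖z + (r / 2) • (‖τ‖⁻¹ • τ) - y‖ = ‖(z - y) + (r / 2) • (‖τ‖⁻¹ • τ)‖ := by congr 1; abel
      _ ≤ ‖z - y‖ + ‖(r / 2) • (‖τ‖⁻¹ • τ)‖ := norm_add_le _ _
      _ < r := by linarith
  obtain ⟨hwC, hwK⟩ := hball _ hw
  have hsub := h.memFunction_add_inner_le hν (h.naturalParam_mem hzero hzC)
    (h.naturalParam_mem hzero hwC)
  rw [h.meanParam_naturalParam hzero hzC, h.meanParam_naturalParam hzero hwC,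
    add_sub_cancel_left, inner_smul_right, inner_smul_right, real_inner_self_eq_norm_mul_norm,
    ← mul_assoc (‖_‖⁻¹), inv_mul_mul_self] at hsub
  have hnn : 0 ≤ (memFunction ν P z).toReal := EReal.toReal_nonneg memFunction_nonneg
  rw [le_div_iff₀ (by linarith), mul_comm]
  linarith

/-- Local boundedness yields convergent subsequences; steepness keeps their limits interior, and
injectivity of the mean map identifies them. -/
lemma IsSteepFamily.continuousAt_naturalParam [IsProbabilityMeasure P] (h : IsSteepFamily P)
    (hν : P ≪ ν) (hzero : 0 ∈ interior (naturalSpace P)) (hy : y ∈ interior (convexSupport P)) :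
    ContinuousAt (naturalParam P) y := by
  obtain ⟨B, hB⟩ := h.eventually_norm_naturalParam_le hν hzero hy
  refine tendsto_of_subseq_tendsto fun u hu => ?_
  obtain ⟨N, hN⟩ := eventually_atTop.1
    (hu.eventually (hB.and (isOpen_interior.eventually_mem hy)))
  obtain ⟨θ, -, φ, hφ, hlim⟩ := tendsto_subseq_of_bounded
    (Metric.isBounded_closedBall (x := (0 : EuclideanSpace ℝ (Fin d))) (r := B))
    (x := fun k => naturalParam P (u (k + N)))
    fun k => by simpa using (hN (k + N) (Nat.le_add_left _ _)).1
  have hmem : ∀ k, u (φ k + N) ∈ interior (convexSupport P) := fun k =>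
    (hN _ (Nat.le_add_left _ _)).2
  have hm : Tendsto (fun k => meanParam P (naturalParam P (u (φ k + N)))) atTop (𝓝 y) := by
    simp_rw [h.meanParam_naturalParam hzero (hmem _)]
    exact hu.comp ((tendsto_add_atTop_nat N).comp hφ.tendsto_atTop)
  obtain ⟨hθ, hθy⟩ := h.mem_interior_of_tendsto
    (fun k => h.naturalParam_mem hzero (hmem k)) hlim hm
  have heq : naturalParam P y = θ := meanParam_injOn ⟨y, hy⟩ (h.naturalParam_mem hzero hy) hθ
    (by rw [h.meanParam_naturalParam hzero hy, hθy])
  exact ⟨fun k => φ k + N, heq ▸ hlim⟩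

/-- The gradient of `κ` inverts the mean parametrization. -/
lemma IsSteepFamily.hasGradientAt_memFunction [IsProbabilityMeasure P] (h : IsSteepFamily P)
    (hν : P ≪ ν) (hzero : 0 ∈ interior (naturalSpace P)) (hy : y ∈ interior (convexSupport P)) :
    HasGradientAt (fun z => (memFunction ν P z).toReal) (naturalParam P y) y := by
  rw [hasGradientAt_iff_isLittleO, Asymptotics.isLittleO_iff]
  intro c hc
  filter_upwards [isOpen_interior.mem_nhds hy,
    Metric.continuousAt_iff'.1 (h.continuousAt_naturalParam hν hzero hy) c hc] with z hz hzc
  have h1 := h.memFunction_add_inner_le hν (h.naturalParam_mem hzero hy)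
    (h.naturalParam_mem hzero hz)
  have h2 := h.memFunction_add_inner_le hν (h.naturalParam_mem hzero hz)
    (h.naturalParam_mem hzero hy)
  rw [h.meanParam_naturalParam hzero hy, h.meanParam_naturalParam hzero hz] at h1 h2
  -- The subgradient inequalities at `y` and `z` trap the first-order error between `0` and this
  -- inner product.
  have h3 : ⟪naturalParam P z - naturalParam P y, z - y⟫_ℝ ≤ c * ‖z - y‖ := by
    refine (real_inner_le_norm _ _).trans (mul_le_mul_of_nonneg_right ?_ (norm_nonneg _))
    rw [← dist_eq_norm]
    exact hzc.le
  rw [← neg_sub z y, inner_neg_right] at h2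
  rw [inner_sub_left] at h3
  rw [Real.norm_eq_abs, abs_le]
  constructor <;> linarith [mul_nonneg hc.le (norm_nonneg (z - y))]

lemma IsSteepFamily.isEssentiallySmooth_memFunction [IsProbabilityMeasure P]
    (h : IsSteepFamily P) (hν : P ≪ ν) (hzero : 0 ∈ interior (naturalSpace P))
    (hC : (interior (convexSupport P)).Nonempty) : IsEssentiallySmooth (memFunction ν P) := by
  have hint := h.interior_dom_memFunction hν hzero
  refine ⟨by rwa [hint], fun y hy => ?_, fun x u hx hu hlim => ?_⟩
  · exact (h.hasGradientAt_memFunction hν hzero (hint ▸ hy)).differentiableAt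
  · rw [hint] at hu
    simp_rw [fun k => (h.hasGradientAt_memFunction hν hzero (hu k)).gradient]
    by_contra hnot
    simp only [tendsto_atTop, not_forall, not_eventually, not_le] at hnot
    obtain ⟨B, hB⟩ := hnot
    -- Without blow-up, a subsequence of gradients converges to some `θ`; it is interior with mean
    -- `x`, so `x` is not a frontier point.
    obtain ⟨θ, -, φ, hφ, hθ⟩ := tendsto_subseq_of_frequently_bounded
      (Metric.isBounded_ball (x := (0 : EuclideanSpace ℝ (Fin d))) (r := B))
      (x := fun k => naturalParam P (u k)) (hB.mono fun k hk => by simpa using hk)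
    have hm : Tendsto (fun k => meanParam P (naturalParam P (u (φ k)))) atTop (𝓝 x) := by
      simp_rw [h.meanParam_naturalParam hzero (hu _)]
      exact hlim.comp hφ.tendsto_atTop
    obtain ⟨hθi, rfl⟩ := h.mem_interior_of_tendsto
      (fun k => h.naturalParam_mem hzero (hu (φ k))) hθ hm
    exact hx.2 (hint ▸ meanParam_mem_interior hC hθi)

lemma IsSteepFamily.isLegendre_memFunction [IsProbabilityMeasure P]
    (h : IsSteepFamily P) (hν : P ≪ ν) (hzero : 0 ∈ interior (naturalSpace P))
    (hC : (interior (convexSupport P)).Nonempty) : IsLegendre (memFunction ν P) := by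
  have hint := h.interior_dom_memFunction hν hzero
  refine ⟨⟨fun x => ?_, ?_⟩, isConvex_memFunction,
    h.isEssentiallySmooth_memFunction hν hzero hC, ?_⟩
  · exact (EReal.bot_lt_zero.trans_le memFunction_nonneg).ne'
  · rw [← hint] at hC
    exact hC.mono interior_subset
  · rw [hint]
    exact h.strictConvexOn_memFunction hν hzero

/-- `κ` vanishes exactly at the mean. -/
lemma IsSteepFamily.memFunction_eq_zero_iff [IsProbabilityMeasure P] (h : IsSteepFamily P)
    (hν : P ≪ ν) (hzero : 0 ∈ interior (naturalSpace P)) :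
    memFunction ν P y = 0 ↔ y = ∫ x, x ∂P := by
  have hm0 : meanParam P 0 = ∫ x, x ∂P := by rw [meanParam, expFamily_zero]
  rw [← hm0]
  constructor
  · intro hy
    -- If `κ(y) = 0`, the lower bound reads `⟪y, η⟫ ≤ ψ(η)`, so `0` minimizes `ψ - ⟪y, ·⟫`; no
    -- attainment of the infimum is needed.
    refine (h.meanParam_eq hzero fun η hη => ?_).symm
    have := le_memFunction (ν := ν) (y := y) (interior_subset hη)
    rw [hy] at this
    have : ⟪y, η⟫_ℝ - psi P η ≤ 0 := by exact_mod_cast this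
    rw [psi_zero, sub_zero]
    linarith
  · rintro rfl
    rw [memFunction_meanParam hν hzero, psi_zero]
    simp

end Legendre

/-! ### Growth of `κ` at infinity. -/

section Coercive

variable {d : ℕ} {ν P : Measure (EuclideanSpace ℝ (Fin d))} {y : EuclideanSpace ℝ (Fin d)}

/-- If `Θ_P` contains a ball of radius `r`, then `κ` grows at least with slope `r`. -/
lemma IsSteepFamily.exists_mul_norm_sub_le [IsProbabilityMeasure P] (h : IsSteepFamily P) {r : ℝ}
    (hr : 0 ≤ r) (hball : Metric.closedBall 0 r ⊆ interior (naturalSpace P)) :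
    ∃ K : ℝ, ∀ y, ((r * ‖y‖ - K : ℝ) : EReal) ≤ memFunction ν P y := by
  obtain ⟨K, hK⟩ := h.exists_psi_le hball
  refine ⟨K, fun y => ?_⟩
  -- Test the lower bound at the parameter of length `r` in direction `y`.
  have hmem : r • (‖y‖⁻¹ • y) ∈ Metric.closedBall (0 : EuclideanSpace ℝ (Fin d)) r := by
    rw [mem_closedBall_zero_iff, norm_smul, norm_smul, norm_inv, norm_norm, Real.norm_of_nonneg hr]
    exact mul_le_of_le_one_right hr inv_mul_le_one
  refine le_trans ?_ (le_memFunction (y := y) (interior_subset (hball hmem)))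
  rw [EReal.coe_le_coe_iff, inner_smul_right, inner_smul_right, real_inner_self_eq_norm_mul_norm,
    ← mul_assoc (‖_‖⁻¹), inv_mul_mul_self]
  linarith [hK _ hmem]

lemma isCoercive_of_mul_norm_sub_le {f : EuclideanSpace ℝ (Fin d) → EReal} {r K : ℝ} (hr : 0 < r)
    (hf : ∀ y, ((r * ‖y‖ - K : ℝ) : EReal) ≤ f y) : IsCoercive f := by
  refine EReal.tendsto_nhds_top_iff_real.2 fun α => ?_
  filter_upwards [tendsto_norm_cobounded_atTop.eventually_gt_atTop ((α + K) / r)] with y hy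
  refine lt_of_lt_of_le ?_ (hf y)
  rw [EReal.coe_lt_coe_iff]
  rw [div_lt_iff₀ hr] at hy
  linarith

lemma IsCoercive.isLevelBounded {f : EuclideanSpace ℝ (Fin d) → EReal} (hf : IsCoercive f) :
    IsLevelBounded f := by
  intro α
  have h := EReal.tendsto_nhds_top_iff_real.1 hf α
  rw [← Bornology.isCobounded_compl_iff, Bornology.isCobounded_def]
  filter_upwards [h] with y hy
  simpa using hy

lemma isSupercoercive_of_forall_mul_norm_sub_le {f : EuclideanSpace ℝ (Fin d) → EReal}
    (hf : ∀ r : ℝ, 0 ≤ r → ∃ K : ℝ, ∀ y, ((r * ‖y‖ - K : ℝ) : EReal) ≤ f y) :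
    IsSupercoercive f := by
  refine EReal.tendsto_nhds_top_iff_real.2 fun α => ?_
  -- A slope exceeding `α` by at least `1` absorbs `K` once `‖y‖ > K`.
  obtain ⟨K, hK⟩ := hf (|α| + 1) (by positivity)
  filter_upwards [tendsto_norm_cobounded_atTop.eventually_gt_atTop (max K 0)] with y hy
  have hpos : 0 < ‖y‖ := (le_max_right _ _).trans_lt hy
  have hlt : α * ‖y‖ < (|α| + 1) * ‖y‖ - K := by
    have := mul_le_mul_of_nonneg_right (le_abs_self α) hpos.le
    linarith [(le_max_left K 0).trans_lt hy]
  rw [EReal.lt_div_iff (by exact_mod_cast hpos) (EReal.coe_ne_top _)]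
  refine lt_of_lt_of_le ?_ (hK y)
  exact_mod_cast hlt

lemma momentGen_lt_top_of_isBounded_support [IsFiniteMeasure P]
    (hb : Bornology.IsBounded P.support) (θ : EuclideanSpace ℝ (Fin d)) : momentGen P θ < ⊤ := by
  obtain ⟨B, hB⟩ := isBounded_iff_forall_norm_le.1 hb
  calc momentGen P θ ≤ ∫⁻ _, ENNReal.ofReal (Real.exp (B * ‖θ‖)) ∂P := by
        refine lintegral_mono_ae ?_
        filter_upwards [Measure.support_mem_ae (μ := P)] with x hx
        refine ENNReal.ofReal_le_ofReal (Real.exp_le_exp.2 ?_)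
        exact (real_inner_le_norm _ _).trans
          (mul_le_mul_of_nonneg_right (hB x hx) (norm_nonneg _))
    _ < ⊤ := by
        rw [lintegral_const]
        exact ENNReal.mul_lt_top ENNReal.ofReal_lt_top (measure_lt_top _ _)

end Coercive

end MEM

theorem mainTheorem4 (d : ℕ) (ν P : Measure (EuclideanSpace ℝ (Fin d)))
    (hν : MEM.IsDominating ν) (hP : P ∈ MEM.distributions ν)
    (hminimal : MEM.IsMinimalFamily P) (hsteep : MEM.IsSteepFamily P)
    (hzero : (0 : EuclideanSpace ℝ (Fin d)) ∈ interior (MEM.naturalSpace P))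
    (hsupport : ¬ P.support.Countable ∨
      (P.support.Countable ∧ IsClosed (convexHull ℝ P.support))) :
    (Integrable (fun x => x) P ∧
      ∀ y, 0 ≤ MEM.memFunction ν P y ∧ (MEM.memFunction ν P y = 0 ↔ y = ∫ x, x ∂P)) ∧
    MEM.IsLegendre (MEM.memFunction ν P) ∧
    (MEM.IsCoercive (MEM.memFunction ν P) ∧ MEM.IsLevelBounded (MEM.memFunction ν P)) ∧
    (((∀ θ, MEM.momentGen P θ < ∞) → MEM.IsSupercoercive (MEM.memFunction ν P)) ∧
      (Bornology.IsBounded P.support → ∀ θ, MEM.momentGen P θ < ∞)) := by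
  have := hP.1
  obtain ⟨r, hr, hball⟩ := Metric.nhds_basis_closedBall.mem_iff.1 (isOpen_interior.mem_nhds hzero)
  obtain ⟨K, hK⟩ := hsteep.exists_mul_norm_sub_le (ν := ν) hr.le hball
  have hcoercive := MEM.isCoercive_of_mul_norm_sub_le hr hK
  refine ⟨⟨?_, fun y => ⟨MEM.memFunction_nonneg, hsteep.memFunction_eq_zero_iff hP.2 hzero⟩⟩,
    hsteep.isLegendre_memFunction hP.2 hzero hminimal.2, ⟨hcoercive, hcoercive.isLevelBounded⟩,
    fun hfin => ?_, fun hb => MEM.momentGen_lt_top_of_isBounded_support hb⟩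
  · simpa [MEM.expFamily_zero] using MEM.integrable_id_expFamily hzero
  · refine MEM.isSupercoercive_of_forall_mul_norm_sub_le fun s hs =>
      hsteep.exists_mul_norm_sub_le hs ?_
    -- With `Θ_P` the whole space, balls of every radius are available, so every slope is reached.
    have huniv : MEM.naturalSpace P = univ := eq_univ_of_forall hfin
    simp [huniv]
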